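/- Let $k$ be an algebraically closed field, and let all schemes, products, morphisms and actions be over $k$. Let $G$ be an algebraic group over $k$ (a group scheme of finite type over $k$), let $n \ge 0$, and let $G$ act on $\mathbb{P}^n = \mathbb{P}^n_k$. Let $T$ be an integral noetherian scheme over $k$ endowed with a transitive action of $G$, that is, an action for which the morphism $G \times T \to T \times T$, $(g,t) \mapsto (gt,t)$, is surjective. Let $G$ act diagonally on $T \times \mathbb{P}^n = \mathbb{P}^n_T$. If $X \subseteq \mathbb{P}^n_T$ is a $G$-stable closed subscheme, that is, a closed subscheme such that the restriction $G \times X \to \mathbb{P}^n_T$ of the action morphism factors through $X$, then $X$ is flat over $T$. -/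

import Mathlib

open CategoryTheory AlgebraicGeometry MonoidalCategory CartesianMonoidalCategory
open scoped MonObj

universe u

section ProjectiveSpace

attribute [local instance] MvPolynomial.gradedAlgebra

/-- The projective space `ℙⁿ` over a field `k`, as a `k`-scheme: `Proj k[x₀, …, xₙ]` for the grading
by total degree, with structure morphism `Proj k[x₀, …, xₙ] ⟶ Spec k[x₀, …, xₙ]₀ ⟶ Spec k`. -/
noncomputable def projSpace (k : Type u) [Field k] (n : ℕ) : Over (Spec (.of k)) :=
  Over.mk (Proj.toSpecZero (MvPolynomial.homogeneousSubmodule (Fin (n + 1)) k) ≫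
    Spec.map (CommRingCat.ofHom
      (algebraMap k (MvPolynomial.homogeneousSubmodule (Fin (n + 1)) k 0))))

end ProjectiveSpace

section Action

variable {C : Type*} [Category C] [CartesianMonoidalCategory C]

/-- The action map `G × (X × Y) ⟶ X × Y`, `(g, (x, y)) ↦ (g x, g y)`. -/
def diagonalSMul (G : C) [MonObj G] (X Y : C) [ModObj G X] [ModObj G Y] :
    G ⊗ (X ⊗ Y) ⟶ X ⊗ Y :=
  lift ((G ◁ fst X Y) ≫ γ[G, X]) ((G ◁ snd X Y) ≫ γ[G, Y])

/-- The diagonal action of `G` on `X × Y`. -/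
@[reducible] def diagonalAction (G : C) [MonObj G] (X Y : C) [ModObj G X] [ModObj G Y] :
    ModObj G (X ⊗ Y) where
  smul := diagonalSMul G X Y
  one_smul := by
    change η[G] ▷ (X ⊗ Y) ≫ diagonalSMul G X Y = (λ_ (X ⊗ Y)).hom
    ext
    · simp only [diagonalSMul, Category.assoc, lift_fst]
      rw [← whisker_exchange_assoc, ModObj.one_smul_self, leftUnitor_naturality]
    · simp only [diagonalSMul, Category.assoc, lift_snd]
      rw [← whisker_exchange_assoc, ModObj.one_smul_self, leftUnitor_naturality]
  mul_smul := by
    change μ[G] ▷ (X ⊗ Y) ≫ diagonalSMul G X Y =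
      (α_ G G (X ⊗ Y)).hom ≫ G ◁ diagonalSMul G X Y ≫ diagonalSMul G X Y
    ext
    · simp only [diagonalSMul, Category.assoc, lift_fst]
      rw [← whisker_exchange_assoc, ModObj.mul_smul_self, ← whiskerLeft_comp_assoc G, lift_fst]
      simp
    · simp only [diagonalSMul, Category.assoc, lift_snd]
      rw [← whisker_exchange_assoc, ModObj.mul_smul_self, ← whiskerLeft_comp_assoc G, lift_snd]
      simp

/-- A morphism `i : Z ⟶ Y` (in practice the inclusion of a closed subscheme) is stable under an
action of `G` on `Y` if the action map restricts to a morphism `G × Z ⟶ Z`, i.e. if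
`G × Z ⟶ G × Y ⟶ Y` factors through `i`. -/
def IsStableSub {G Z Y : C} [MonObj G] (act : ModObj G Y) (i : Z ⟶ Y) : Prop :=
  ∃ a : G ⊗ Z ⟶ Z, a ≫ i = (G ◁ i) ≫ act.smul

end Action

/-- An action of a group scheme `G` over `S` on an `S`-scheme `T` is transitive if
`G ×ₛ T ⟶ T ×ₛ T`, `(g, t) ↦ (g t, t)` is surjective. -/
def IsTransitiveAction {S : Scheme.{u}} (G T : Over S) [MonObj G] [ModObj G T] : Prop :=
  Surjective (ModObj.leftSMul G T).left

/-!
Let `f : X ⟶ T` be the projection. It is `G`-equivariant, because `X` is stable in `T × ℙⁿ` and so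
inherits an action of `G`. Flatness of `f` is obtained by fpqc descent from the generic point of `T`.

Let `j : K ⟶ T` be the inclusion of the spectrum of the function field of `T`, and let `q` be the
orbit map `G × K ⟶ T`, `(g, z) ↦ g j(z)`.

* `q` is flat: `j` is flat, and the action map `G × T ⟶ T` is flat since up to the automorphism
  `(g, t) ↦ (g, g t)` of `G × T` it is the projection (`flat_whiskerLeft_comp_smul`).
* `q` is surjective: by transitivity `G × K ⟶ T × K` is surjective, as a base change of
  `G × T ⟶ T × T`, and so is the projection `T × K ⟶ T`
  (`IsTransitiveAction.surjective_whiskerLeft_comp_smul`).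
* `q` is quasi-compact, because `G × K` is quasi-compact and `T` is quasi-separated.
* By equivariance the base change of `f` along `q` is `G × X_K ⟶ G × K`, where `X_K ⟶ K` is the
  generic fibre of `f` (`isPullback_whiskerLeft_comp_smul`). It is flat since `K` is the spectrum of
  a field.
-/

/-! ### Equivariant morphisms in a cartesian monoidal category -/

section Equivariant

variable {C : Type*} [Category C] [CartesianMonoidalCategory C]

/-- A subobject stable under an action inherits an action. -/
@[reducible] noncomputable def IsStableSub.modObj {G Z Y : C} [MonObj G] {act : ModObj G Y}
    {i : Z ⟶ Y} [Mono i] (h : IsStableSub act i) : ModObj G Z where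
  smul := h.choose
  one_smul := by
    have e : h.choose ≫ i = G ◁ i ≫ act.smul := h.choose_spec
    have e₁ : η[G] ▷ Y ≫ act.smul = (λ_ Y).hom := ModObj.one_smul_self G Y
    change η[G] ▷ Z ≫ h.choose = (λ_ Z).hom
    rw [← cancel_mono i, Category.assoc, e, ← whisker_exchange_assoc, e₁, leftUnitor_naturality]
  mul_smul := by
    have e : h.choose ≫ i = G ◁ i ≫ act.smul := h.choose_spec
    have e₁ : μ[G] ▷ Y ≫ act.smul = (α_ G G Y).hom ≫ G ◁ act.smul ≫ act.smul :=
      ModObj.mul_smul_self G Y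
    change μ[G] ▷ Z ≫ h.choose = (α_ G G Z).hom ≫ G ◁ h.choose ≫ h.choose
    rw [← cancel_mono i]
    simp only [Category.assoc, e]
    rw [← whisker_exchange_assoc, e₁, ← whiskerLeft_comp_assoc G, e]
    simp

/-- If `f : X ⟶ Y` is equivariant under a group object `G` and `P` is the base change of `X` along
`j : Z ⟶ Y`, then `G × P` is the base change of `X` along `G × Z ⟶ Y`, `(g, z) ↦ g j(z)`: a point of
this base change is a triple `(x, g, z)` with `f(x) = g j(z)`, and it corresponds to
`(g, (g⁻¹ x, z))`. -/
theorem isPullback_whiskerLeft_comp_smul {G : C} [GrpObj G] {P X Y Z : C} [ModObj G X] [ModObj G Y]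
    {f : X ⟶ Y} {j : Z ⟶ Y} {p : P ⟶ X} {r : P ⟶ Z} (hf : γ[G, X] ≫ f = (G ◁ f) ≫ γ[G, Y])
    (h : IsPullback p r f j) :
    IsPullback ((G ◁ p) ≫ γ[G, X]) (G ◁ r) f ((G ◁ j) ≫ γ[G, Y]) := by
  have map_smul {W : C} (g : W ⟶ G) (x : W ⟶ X) : (g • x) ≫ f = g • (x ≫ f) := by
    simp [Hom.smul_def, hf]
  have comp_whiskerLeft_smul {A B W : C} [ModObj G B] (a : A ⟶ B) (w : W ⟶ G ⊗ A) :
      w ≫ (G ◁ a) ≫ γ[G, B] = (w ≫ fst G A) • (w ≫ snd G A ≫ a) := by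
    rw [Hom.smul_def, ← Category.assoc]
    congr 1
    ext <;> simp
  refine ⟨⟨by simp only [Category.assoc, hf, ← whiskerLeft_comp_assoc, h.w]⟩,
    ⟨Limits.PullbackCone.IsLimit.mk _
      (fun s ↦ lift (s.snd ≫ fst _ _)
        (h.lift ((s.snd ≫ fst _ _)⁻¹ • s.fst) (s.snd ≫ snd _ _) ?_)) ?_ ?_ ?_⟩⟩
  · rw [map_smul, inv_smul_eq_iff, s.condition, comp_whiskerLeft_smul, Category.assoc]
  · intro s
    rw [comp_whiskerLeft_smul, lift_fst, lift_snd_assoc, h.lift_fst, smul_inv_smul]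
  · intro s
    refine CartesianMonoidalCategory.hom_ext _ _ ?_ ?_ <;> simp
  · intro s m h₁ h₂
    have e₁ : m ≫ fst G P = s.snd ≫ fst G Z := by simp [← h₂]
    refine CartesianMonoidalCategory.hom_ext _ _ (by simp [e₁]) (h.hom_ext ?_ ?_)
    · rw [lift_snd, h.lift_fst, eq_inv_smul_iff, ← h₁, ← e₁, comp_whiskerLeft_smul, Category.assoc]
    · simp [← h₂]

/-- For `j : Z ⟶ T`, the map `G × Z ⟶ T × Z`, `(g, z) ↦ (g j(z), z)` is a base change of
`G × T ⟶ T × T`, `(g, t) ↦ (g t, t)`. -/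
theorem isPullback_leftSMul {G T Z : C} [MonObj G] [ModObj G T] (j : Z ⟶ T) :
    IsPullback (G ◁ j) (lift ((G ◁ j) ≫ γ[G, T]) (snd G Z)) (ModObj.leftSMul G T) (T ◁ j) := by
  refine ⟨⟨by ext <;> simp⟩, ⟨Limits.PullbackCone.IsLimit.mk _
    (fun s ↦ lift (s.fst ≫ fst _ _) (s.snd ≫ snd _ _)) ?_ ?_ ?_⟩⟩
  · intro s
    have := s.condition =≫ snd _ _
    ext
    · simp
    · simpa using this.symm
  · intro s
    have h₁ := s.condition =≫ fst _ _
    have h₂ := s.condition =≫ snd _ _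
    simp only [Category.assoc, ModObj.leftSMul_fst, ModObj.leftSMul_snd, whiskerLeft_fst,
      whiskerLeft_snd] at h₁ h₂
    ext
    · rw [← h₁]
      simp only [Category.assoc, lift_fst, lift_whiskerLeft_assoc, ← h₂]
      simp
    · simp
  · intro s m h₁ h₂
    ext
    · simp [← h₁]
    · simp [← h₂]

end Equivariant

/-! ### Flat morphisms -/

theorem RingHom.Flat.codescendsAlong_faithfullyFlat :
    RingHom.CodescendsAlong RingHom.Flat RingHom.FaithfullyFlat := by
  refine .mk _ RingHom.Flat.respectsIso fun R S T _ _ _ _ _ h h' ↦ ?_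
  rw [RingHom.flat_algebraMap_iff] at h' ⊢
  rw [RingHom.faithfullyFlat_algebraMap_iff] at h
  exact Module.Flat.of_flat_tensorProduct R T S

namespace AlgebraicGeometry

/-- Flatness satisfies fpqc descent. -/
instance Flat.descendsAlong_surjective_inf_flat_inf_quasicompact :
    MorphismProperty.DescendsAlong @Flat.{u} (@Surjective ⊓ @Flat ⊓ @QuasiCompact) :=
  HasRingHomProperty.descendsAlong_flat RingHom.Flat.codescendsAlong_faithfullyFlat

instance Scheme.flat_fromSpecStalk (X : Scheme.{u}) (x : X) : Flat (X.fromSpecStalk x) := by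
  obtain ⟨U, hU, hx, -⟩ := exists_isAffineOpen_mem_and_subset (U := ⊤) (x := x) (by simp)
  rw [← hU.fromSpecStalk_eq_fromSpecStalk hx, IsAffineOpen.fromSpecStalk]
  have : Flat (Spec.map (X.presheaf.germ U x hx)) := by
    rw [Flat.SpecMap_iff]
    algebraize [(X.presheaf.germ U x hx).hom]
    have := hU.isLocalization_stalk ⟨x, hx⟩
    exact IsLocalization.flat _ (hU.primeIdealOf ⟨x, hx⟩).asIdeal.primeCompl
  infer_instance

/-! ### Orbit maps of group scheme actions -/

section

variable {S : Scheme.{u}} {G T Z : Over S}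

theorem flat_whiskerLeft (G : Over S) {A B : Over S} (f : A ⟶ B) [Flat f.left] :
    Flat (G ◁ f).left :=
  MorphismProperty.pullbackMap (P := @Flat) (i₁ := 𝟙 G.left) inferInstance ‹Flat f.left›
    (by simp) (by simp)

/-- The action map is the base change of `G ⟶ S` along `T ⟶ S`, since `T ⟶ S` is equivariant for the
trivial action on `S`. -/
theorem flat_smul [GrpObj G] [Flat G.hom] [ModObj G T] : Flat γ[G, T].left := by
  let _ : ModObj G (𝟙_ (Over S)) := .trivialAction G _
  have h : IsPullback (𝟙 T) (toUnit T) (toUnit T) (𝟙 (𝟙_ (Over S))) := .of_horiz_isIso ⟨by simp⟩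
  have := (isPullback_whiskerLeft_comp_smul (G := G) (toUnit_unique _ _) h).map (Over.forget S)
  have h₂ : (G ◁ 𝟙 (𝟙_ (Over S))) ≫ γ[G, 𝟙_ (Over S)] = snd _ _ := by simp; rfl
  rw [h₂] at this
  simpa using MorphismProperty.of_isPullback (P := @Flat) this.flip (by dsimp; infer_instance)

/-- The orbit map `G × Z ⟶ T`, `(g, z) ↦ g j(z)`, of a flat morphism `j : Z ⟶ T` is flat. -/
theorem flat_whiskerLeft_comp_smul [GrpObj G] [Flat G.hom] [ModObj G T] (j : Z ⟶ T) [Flat j.left] :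
    Flat ((G ◁ j) ≫ γ[G, T]).left := by
  have := flat_whiskerLeft G j
  have : Flat γ[G, T].left := flat_smul
  rw [Over.comp_left]
  infer_instance

theorem IsTransitiveAction.surjective_whiskerLeft_comp_smul [MonObj G] [ModObj G T]
    (hT : IsTransitiveAction G T) (j : Z ⟶ T) [Surjective Z.hom] :
    Surjective ((G ◁ j) ≫ γ[G, T]).left := by
  have hs := MorphismProperty.of_isPullback (P := @Surjective)
    ((isPullback_leftSMul (G := G) j).map (Over.forget S)) hT
  have e : (G ◁ j) ≫ γ[G, T] = lift ((G ◁ j) ≫ γ[G, T]) (snd G Z) ≫ fst T Z := by simp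
  rw [e, Over.comp_left]
  have : Surjective (fst T Z).left := by dsimp; infer_instance
  have : Surjective (lift ((G ◁ j) ≫ γ[G, T]) (snd G Z)).left := hs
  infer_instance

end

end AlgebraicGeometry

theorem mainTheorem3 (k : Type u) [Field k] [IsAlgClosed k] (n : ℕ)
    (G : Over (Spec (.of k))) [GrpObj G] [LocallyOfFiniteType G.hom] [QuasiCompact G.hom]
    [ModObj G (projSpace k n)]
    (T : Over (Spec (.of k))) [AlgebraicGeometry.IsIntegral T.left]
    [AlgebraicGeometry.IsNoetherian T.left]
    [ModObj G T] (hT : IsTransitiveAction G T)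
    (X : Over (Spec (.of k))) (i : X ⟶ T ⊗ projSpace k n) [IsClosedImmersion i.left]
    (hX : IsStableSub (diagonalAction G T (projSpace k n)) i) :
    Flat (i ≫ fst T (projSpace k n)).left := by
  have : Mono i := Over.mono_of_mono_left i
  let _ : ModObj G X := hX.modObj
  let Y := projSpace k n
  let f : X ⟶ T := i ≫ fst T Y
  have hf : γ[G, X] ≫ f = (G ◁ f) ≫ γ[G, T] := by
    have e : γ[G, X] ≫ i = (G ◁ i) ≫ diagonalSMul G T Y := hX.choose_spec
    simp only [f]
    rw [reassoc_of% e, diagonalSMul, lift_fst, whiskerLeft_comp_assoc]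
  -- Since `T` is integral, its local ring at the generic point is a field.
  let K : Over (Spec (.of k)) :=
    Over.mk (T.left.fromSpecStalk (genericPoint T.left) ≫ T.hom)
  let j : K ⟶ T := Over.homMk (T.left.fromSpecStalk (genericPoint T.left))
  have : Subsingleton K.left := inferInstanceAs (Subsingleton (PrimeSpectrum T.left.functionField))
  have : AlgebraicGeometry.IsIntegral K.left :=
    inferInstanceAs (AlgebraicGeometry.IsIntegral (Spec T.left.functionField))
  have : Flat j.left := inferInstanceAs (Flat (T.left.fromSpecStalk _))
  have : Surjective K.hom := ⟨Function.surjective_to_subsingleton (α := K.left) (β := Spec _) _⟩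
  have : Flat (G ◁ Limits.pullback.snd f j).left := flat_whiskerLeft G _
  have : Flat ((G ◁ j) ≫ γ[G, T]).left := flat_whiskerLeft_comp_smul j
  have : Surjective ((G ◁ j) ≫ γ[G, T]).left := hT.surjective_whiskerLeft_comp_smul j
  have : CompactSpace (G ⊗ K).left :=
    inferInstanceAs (CompactSpace ↑(Limits.pullback G.hom K.hom))
  have : QuasiCompact ((G ◁ j) ≫ γ[G, T]).left := inferInstance
  exact MorphismProperty.of_isPullback_of_descendsAlong (P := @Flat)
    (Q := @Surjective ⊓ @Flat ⊓ @QuasiCompact)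
    ((isPullback_whiskerLeft_comp_smul hf (.of_hasPullback f j)).map (Over.forget _)).flip
    ⟨⟨‹_›, ‹_›⟩, ‹_›⟩ ‹_›
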